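/- Throughout, a weighted graph is a finite simple graph $G$ with a weighting $w:E(G)\to\mathbb{R}^+\cup\{\infty\}$, where $\mathbb{R}^+=(0,\infty)$. The distance $\mathrm{dist}_G(u,v)$ is the minimum, over all paths from $u$ to $v$, of the sum of the weights of the edges of the path ($\infty$ if there is no path). For an integer $n\ge 0$, a function $f:\mathbb{R}^+\to\mathbb{R}^+$ is an $n$-dimensional control function for $G$ if for every real $r>0$ there are $n+1$ collections $\mathcal{C}_1,\dots,\mathcal{C}_{n+1}$ of subsets of $V(G)$, whose members together cover $V(G)$, such that for each $i$: any two distinct sets $S,T\in\mathcal{C}_i$ satisfy $\mathrm{dist}_G(u,v)>r$ for all $u\in S$, $v\in T$; and each $S\in\mathcal{C}_i$ satisfies $\mathrm{dist}_G(u,v)\le f(r)$ for all $u,v\in S$. The function $f$ is a dilation if there is a real $c>0$ with $f(r)\le cr$ for all $r>0$. The Assouad–Nagata dimension $\mathrm{ANdim}(\mathcal{G})$ of a class $\mathcal{G}$ of weighted graphs is the smallest integer $n\ge 0$ such that some dilation $f$ is an $n$-dimensional control function for every $G\in\mathcal{G}$ simultaneously, and $\infty$ if there is no such $n$. The treewidth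 of a weighted graph is the treewidth of its underlying unweighted graph, that is, the minimum over all tree-decompositions (indexed by finite trees) of the maximum bag size minus one. **Theorem.** Let $k\ge 0$ be an integer, and let $\mathcal{G}$ be any class (an arbitrary collection, for instance one closed under isomorphism) of weighted graphs of treewidth at most $k$. Then $\mathrm{ANdim}(\mathcal{G})\le 1$. -/

import Mathlib

open scoped ENNReal

universe u

/-- A finite weighted graph: a finite simple graph together with a weighting of its edges by
positive reals or infinity. -/
structure WeightedGraph : Type (u + 1) where
  V : Type u
  [finite : Finite V]
  graph : SimpleGraph V
  weight : graph.edgeSet → ℝ≥0∞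
  weight_pos : ∀ e, 0 < weight e

attribute [instance] WeightedGraph.finite

namespace WeightedGraph

/-- The length of a walk: the sum of the weights of its edges. -/
def length (G : WeightedGraph.{u}) : {x y : G.V} → G.graph.Walk x y → ℝ≥0∞
  | _, _, .nil => 0
  | _, _, .cons' x y _ h p => G.weight ⟨s(x, y), h⟩ + G.length p

/-- The distance: the length of a shortest path, or `∞` if there is no path.
(The infimum is a minimum, since a finite graph has finitely many paths.) -/
noncomputable def dist (G : WeightedGraph.{u}) (x y : G.V) : ℝ≥0∞ :=
  ⨅ p : G.graph.Path x y, G.length p.1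

/-- The weak diameter of a vertex set, measured in the whole graph. -/
noncomputable def wdiam (G : WeightedGraph.{u}) (S : Set G.V) : ℝ≥0∞ :=
  ⨆ x ∈ S, ⨆ y ∈ S, G.dist x y

/-- Two vertex sets are `r`-disjoint if all distances between them exceed `r`. -/
def RDisjoint (G : WeightedGraph.{u}) (r : ℝ) (S T : Set G.V) : Prop :=
  ∀ x ∈ S, ∀ y ∈ T, ENNReal.ofReal r < G.dist x y

/-- `f : ℝ⁺ → ℝ⁺` is an `n`-dimensional control function for `G`. -/
def IsControlFunction (G : WeightedGraph.{u}) (n : ℕ)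
    (f : Set.Ioi (0 : ℝ) → Set.Ioi (0 : ℝ)) : Prop :=
  ∀ r : Set.Ioi (0 : ℝ), ∃ C : Fin (n + 1) → Set (Set G.V),
    (⋃ i, ⋃ S ∈ C i, S) = Set.univ ∧
    (∀ i, (C i).Pairwise (G.RDisjoint (r : ℝ))) ∧
    (∀ i, ∀ S ∈ C i, G.wdiam S ≤ ENNReal.ofReal (f r : ℝ))

end WeightedGraph

/-- `f : ℝ⁺ → ℝ⁺` is a dilation if it is bounded above by a linear function. -/
def IsDilation (f : Set.Ioi (0 : ℝ) → Set.Ioi (0 : ℝ)) : Prop :=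
  ∃ c : ℝ, 0 < c ∧ ∀ r : Set.Ioi (0 : ℝ), (f r : ℝ) ≤ c * (r : ℝ)

/-- The Assouad–Nagata dimension of a class of weighted graphs: the smallest `n` for which one
dilation is an `n`-dimensional control function for all members of the class, or `∞` if there
is no such `n`. -/
noncomputable def ANdim (𝒢 : Set WeightedGraph.{u}) : ℕ∞ :=
  ⨅ (n : ℕ) (_ : ∃ f, IsDilation f ∧ ∀ G ∈ 𝒢, G.IsControlFunction n f), (n : ℕ∞)

/-- A tree-decomposition of a graph, indexed by the nodes of a finite (nonempty) tree. -/
structure TreeDecomposition {V : Type u} (G : SimpleGraph V) where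
  ι : Type
  [finite : Finite ι]
  tree : SimpleGraph ι
  isTree : tree.IsTree
  bag : ι → Set V
  /-- the nodes whose bags contain a given vertex induce a nonempty connected subgraph -/
  connected : ∀ v, (tree.induce {t | v ∈ bag t}).Connected
  edge : ∀ ⦃x y⦄, G.Adj x y → ∃ t, x ∈ bag t ∧ y ∈ bag t

/-- The width: the maximum size of a bag, minus one. -/
noncomputable def TreeDecomposition.width {V : Type u} {G : SimpleGraph V}
    (D : TreeDecomposition G) : ℤ :=
  ((⨆ t, (D.bag t).ncard : ℕ) : ℤ) - 1

/-- The treewidth of a finite graph: the minimum width of a tree-decomposition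
(so the graph without vertices has treewidth `-1`). -/
noncomputable def SimpleGraph.treewidth {V : Type u} [Finite V] (G : SimpleGraph V) : ℤ :=
  sInf {w | ∃ D : TreeDecomposition G, D.width = w}

/-- The infimum defining the treewidth is attained. -/
theorem SimpleGraph.exists_width_eq_treewidth {V : Type u} [Finite V] (G : SimpleGraph V) :
    ∃ D : TreeDecomposition G, D.width = G.treewidth := by
  refine Int.csInf_mem (s := {w | ∃ D : TreeDecomposition G, D.width = w}) ?_ ?_
  · refine ⟨_, { ι := Unit, tree := ⊥, isTree := ?_, bag := fun _ => Set.univ,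
                 connected := ?_, edge := ?_ }, rfl⟩
    · exact SimpleGraph.IsTree.of_subsingleton
    · intro v
      have : Nonempty {t : Unit | v ∈ (Set.univ : Set V)} := ⟨⟨(), Set.mem_univ v⟩⟩
      exact ⟨SimpleGraph.Preconnected.of_subsingleton⟩
    · intro x y _
      exact ⟨(), Set.mem_univ x, Set.mem_univ y⟩
  · refine ⟨-1, ?_⟩
    rintro _ ⟨D, rfl⟩
    unfold TreeDecomposition.width
    omega

/-! The theorem follows from a colouring statement: for each scale, the vertices can be coloured
with two colours so that chains of equally coloured vertices with short steps have bounded weak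
diameter. The components of the two colours form the two collections, and measuring length in units
of `r` makes the control function linear.

The colouring (`RootedBags.exists_coloring`) is found by induction on the maximum number of vertices
of `W` in a bag. Removing vertices must not destroy distances, so `RootedBags.Within` lets a chain
jump between any two vertices of `W` in a common bag, at the cost `E` of the original graph. In the
rooted tree, anchors are chosen greedily from the root: a node is an anchor if its bag avoids the `3
* r`-neighbourhoods of the bags of all smaller anchors. Each vertex is assigned to the greatest
anchor below its top node. Those assigned to `m` and far from the bag at `m` form a region that
meets each bag in fewer vertices (`ncard_bag_inter_region_le`), so induction colours it, at a larger
scale `r'`.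

The colourings are glued by `IsLayered`: near the adhesion set of an anchor, colours are copied from
that set; then come a layer of colour `false` and a layer of colour `true`, which no monochromatic
component crosses. Hence a component has a single stage `m` (`isStage_of_monoAdj`) and, up to
bounded error, follows a monochromatic `r'`-chain of vertices assigned to `m`, or else it stays near
one adhesion set (`within_of_monoAdj`). Away from the boundedly many balls around the bag at `m`,
the induction hypothesis bounds such a chain; `chain_le_ballBound` accounts for the balls. -/

open Relation

/-! ### Abstract distances and chains meeting few balls -/

/-- `E x y a` is to be read as "the distance from `x` to `y` is at most `a`". -/
structure IsLengthRel {V : Type*} (E : V → V → ℝ → Prop) : Prop where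
  nonneg : ∀ {x y a}, E x y a → 0 ≤ a
  refl : ∀ x, E x x 0
  symm : ∀ {x y a}, E x y a → E y x a
  trans : ∀ {x y z a b}, E x y a → E y z b → E x z (a + b)
  mono : ∀ {x y a b}, E x y a → a ≤ b → E x y b

/-- A diameter bound for chains that meet at most `n` balls of radius `ρ`, have steps of length at
most `s`, and have diameter at most `b` as long as they avoid the balls. -/
def ballBound (s ρ b : ℝ) : ℕ → ℝ
  | 0 => b
  | n + 1 => 2 * (ballBound s ρ b n + s + ρ)

theorem ballBound_nonneg {s ρ b : ℝ} (hs : 0 ≤ s) (hρ : 0 ≤ ρ) (hb : 0 ≤ b) (n : ℕ) :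
    0 ≤ ballBound s ρ b n := by
  induction n with
  | zero => exact hb
  | succ n ih => simp only [ballBound]; positivity

theorem ballBound_mono {s ρ b : ℝ} (hs : 0 ≤ s) (hρ : 0 ≤ ρ) (hb : 0 ≤ b) :
    Monotone (ballBound s ρ b) := by
  refine monotone_nat_of_le_succ fun n => ?_
  have := ballBound_nonneg hs hρ hb n
  simp only [ballBound]; linarith

/-- Induction on the number of balls. A chain either avoids the ball around `a`, or has an initial
and a final segment that avoid it and end within `s + ρ` of `a`; the two ends are then joined
through `a`, however long the middle part is. -/
theorem IsLengthRel.chain_le_ballBound {V : Type*} {E : V → V → ℝ → Prop} (hE : IsLengthRel E)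
    {s ρ b : ℝ} (hs : 0 ≤ s) (hρ : 0 ≤ ρ) (hb : 0 ≤ b) (A : Finset V) :
    ∀ (R : V → V → Prop), (∀ x y, R x y → R y x) → (∀ x y, R x y → E x y s) →
    (∀ x y, ReflTransGen (fun x y => R x y ∧ (∀ a ∈ A, ¬ E x a ρ) ∧ ∀ a ∈ A, ¬ E y a ρ) x y →
      E x y b) →
    ∀ x y, ReflTransGen R x y → E x y (ballBound s ρ b A.card) := by
  classical
  induction A using Finset.induction_on with
  | empty =>
    intro R _ _ h x y hxy
    exact h x y (by simpa using hxy)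
  | insert a A ha ih =>
    intro R hsymm hlen h x y hxy
    rw [Finset.card_insert_of_notMem ha]
    set R' : V → V → Prop := fun x y => R x y ∧ ¬ E x a ρ ∧ ¬ E y a ρ with hR'
    set F := ballBound s ρ b A.card with hF
    have hF0 : 0 ≤ F := ballBound_nonneg hs hρ hb _
    have key : ∀ x y, ReflTransGen R' x y → E x y F := by
      refine ih R' (fun x y h => ⟨hsymm _ _ h.1, h.2.2, h.2.1⟩) (fun x y h => hlen _ _ h.1) ?_
      intro x y hxy
      refine h x y (ReflTransGen.mono ?_ _ _ hxy)
      rintro x y ⟨⟨h1, h2, h3⟩, h4, h5⟩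
      simp only [Finset.mem_insert, forall_eq_or_imp]
      exact ⟨h1, ⟨h2, h4⟩, h3, h5⟩
    have near : ∀ x y, ReflTransGen R x y → ReflTransGen R' x y ∨ E x a (F + s + ρ) := by
      intro x y hxy
      have : ReflTransGen R' x y ∨ ∃ w, ReflTransGen R' x w ∧ E w a (s + ρ) := by
        induction hxy using ReflTransGen.head_induction_on with
        | refl => exact Or.inl .refl
        | @head x z hxz _ ih =>
          by_cases hx : E x a ρ
          · exact Or.inr ⟨x, .refl, hE.mono hx (by linarith)⟩
          by_cases hz : E z a ρ
          · exact Or.inr ⟨x, .refl, hE.trans (hlen _ _ hxz) hz⟩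
          have : R' x z := ⟨hxz, hx, hz⟩
          rcases ih with ih | ⟨w, h1, h2⟩
          · exact Or.inl (ih.head this)
          · exact Or.inr ⟨w, h1.head this, h2⟩
      rcases this with h | ⟨w, h1, h2⟩
      · exact Or.inl h
      · right
        have := hE.trans (key _ _ h1) h2
        exact hE.mono this (by linarith)
    have hyx : ReflTransGen R y x := by
      induction hxy with
      | refl => exact .refl
      | tail _ h ih => exact ih.head (hsymm _ _ h)
    simp only [ballBound]
    rcases near x y hxy with h1 | h1
    · exact hE.mono (key _ _ h1) (by linarith)
    rcases near y x hyx with h2 | h2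
    · exact hE.mono (hE.symm (key _ _ h2)) (by linarith)
    · exact hE.mono (hE.trans h1 (hE.symm h2)) (by linarith)

/-! ### Rooted tree-decompositions and chains through bags -/

/-- A rooted tree-decomposition: the nodes are ordered as a forest, and every vertex `v` lies in
the bags of a connected set of nodes with least element `top v`. -/
structure RootedBags (V I : Type*) [PartialOrder I] where
  bag : I → Set V
  top : V → I
  top_mem : ∀ v, v ∈ bag (top v)
  top_le : ∀ {v s}, v ∈ bag s → top v ≤ s
  convex : ∀ {v t s}, top v ≤ t → t ≤ s → v ∈ bag s → v ∈ bag t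
  total : ∀ {s t u : I}, s ≤ u → t ≤ u → s ≤ t ∨ t ≤ s

namespace RootedBags

variable {V I : Type*} [PartialOrder I] (B : RootedBags V I) (E : V → V → ℝ → Prop) (W : Set V)

/-- `x` and `y` are joined by a chain of total length at most `a` inside `W`, any two consecutive
members of which share a bag. -/
inductive Within : V → V → ℝ → Prop
  | refl (x : V) {a : ℝ} : 0 ≤ a → Within x x a
  | cons {x y z : V} {s : I} {a b : ℝ} : x ∈ W → y ∈ W → x ∈ B.bag s → y ∈ B.bag s → E x y a →
      Within y z b → Within x z (a + b)

variable {B E W}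

theorem mem_bag_of_not_le {v : V} {s t : I} (hv : v ∈ B.bag s) (hts : t ≤ s)
    (ht : ¬ t ≤ B.top v) : v ∈ B.bag t :=
  B.convex ((B.total (B.top_le hv) hts).resolve_right ht) hts hv

theorem Within.single {x y : V} {s : I} {a : ℝ} (hx : x ∈ W) (hy : y ∈ W) (hxs : x ∈ B.bag s)
    (hys : y ∈ B.bag s) (h : E x y a) : B.Within E W x y a := by
  simpa using Within.cons hx hy hxs hys h (Within.refl y le_rfl)

theorem Within.nonneg (hE : IsLengthRel E) {x y : V} {a : ℝ} (h : B.Within E W x y a) :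
    0 ≤ a := by
  induction h with
  | refl _ h => exact h
  | cons _ _ _ _ h _ ih => exact add_nonneg (hE.nonneg h) ih

theorem Within.mono {x y : V} {a b : ℝ} (h : B.Within E W x y a) (hab : a ≤ b) :
    B.Within E W x y b := by
  induction h generalizing b with
  | refl _ h => exact .refl _ (h.trans hab)
  | @cons x y z s c d hx hy hxs hys h _ ih =>
    have := Within.cons hx hy hxs hys h (ih (b := b - c) (by linarith))
    simpa using this

theorem Within.trans {x y z : V} {a b : ℝ} (h : B.Within E W x y a) (h' : B.Within E W y z b) :
    B.Within E W x z (a + b) := by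
  induction h with
  | refl _ h => exact h'.mono (by linarith)
  | cons hx hy hxs hys h _ ih => rw [add_assoc]; exact .cons hx hy hxs hys h (ih h')

theorem Within.symm (hE : IsLengthRel E) {x y : V} {a : ℝ} (h : B.Within E W x y a) :
    B.Within E W y x a := by
  induction h with
  | refl _ h => exact .refl _ h
  | cons hx hy hxs hys h _ ih =>
    rw [add_comm]
    exact ih.trans (.single hy hx hys hxs (hE.symm h))

theorem isLengthRel_within (hE : IsLengthRel E) : IsLengthRel (B.Within E W) where
  nonneg h := h.nonneg hE
  refl x := .refl x le_rfl
  symm h := h.symm hE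
  trans h h' := h.trans h'
  mono h h' := h.mono h'

theorem Within.mono_set {W' : Set V} (hW : W' ⊆ W) {x y : V} {a : ℝ}
    (h : B.Within E W' x y a) : B.Within E W x y a := by
  induction h with
  | refl _ h => exact .refl _ h
  | cons hx hy hxs hys h _ ih => exact .cons (hW hx) (hW hy) hxs hys h ih

theorem Within.rel (hE : IsLengthRel E) {x y : V} {a : ℝ} (h : B.Within E W x y a) :
    E x y a := by
  induction h with
  | refl _ h => exact hE.mono (hE.refl _) h
  | cons _ _ _ _ h _ ih => exact hE.trans h ih

variable (B W) in
/-- The vertices of the bag at `q` that also lie in bags outside the subtree above `q`. -/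
def adhesion (q : I) : Set V := {v | v ∈ W ∧ v ∈ B.bag q ∧ ¬ q ≤ B.top v}

/-- A chain that leaves the subtree above `t` passes through the adhesion set of `t`. -/
theorem Within.exists_mem_adhesion (hE : IsLengthRel E) {x y : V} {a : ℝ} {s s' t : I}
    (h : B.Within E W x y a) (hx : x ∈ W) (hts : t ≤ s) (hxs : x ∈ B.bag s) (hts' : ¬ t ≤ s')
    (hys' : y ∈ B.bag s') :
    ∃ w ∈ B.adhesion W t, B.Within E W x w a ∧ B.Within E W w y a := by
  have base : ∀ {x s s'}, t ≤ s → x ∈ B.bag s → ¬ t ≤ s' → x ∈ B.bag s' → x ∈ W →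
      x ∈ B.adhesion W t := by
    intro x s s' hts hxs hts' hxs' hx
    have : ¬ t ≤ B.top x := fun h => hts' (h.trans (B.top_le hxs'))
    exact ⟨hx, mem_bag_of_not_le hxs hts this, this⟩
  induction h generalizing s with
  | refl x ha => exact ⟨x, base hts hxs hts' hys' hx, .refl x ha, .refl x ha⟩
  | @cons x y z s₀ a b _ hy hxs₀ hys₀ h hyz ih =>
    have ha := hE.nonneg h
    by_cases ht : t ≤ s₀
    · obtain ⟨w, hw, h1, h2⟩ := ih hy ht hys₀ hys'
      exact ⟨w, hw, .cons hx hy hxs₀ hys₀ h h1, h2.mono (by linarith)⟩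
    · refine ⟨x, base hts hxs ht hxs₀ hx, .refl x ?_, .cons hx hy hxs₀ hys₀ h hyz⟩
      have := hyz.nonneg hE
      linarith

end RootedBags

/-! ### Greedy anchors and their regions -/

namespace RootedBags

variable {V I : Type*} [PartialOrder I] {B : RootedBags V I} {E : V → V → ℝ → Prop} {W : Set V}

variable (B E W) in
/-- `x` has distance at most `ρ` from the bag at `q`. -/
def NearBag (ρ : ℝ) (q : I) (x : V) : Prop := ∃ v, v ∈ W ∧ v ∈ B.bag q ∧ B.Within E W x v ρ

variable (B E W) in
/-- `x` has distance at most `ρ` from the adhesion set of `q`. -/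
def NearAdhesion (ρ : ℝ) (q : I) (x : V) : Prop := ∃ v ∈ B.adhesion W q, B.Within E W x v ρ

theorem NearAdhesion.nearBag {ρ : ℝ} {q : I} {x : V} (h : B.NearAdhesion E W ρ q x) :
    B.NearBag E W ρ q x := by
  obtain ⟨v, hv, h⟩ := h
  exact ⟨v, hv.1, hv.2.1, h⟩

theorem NearAdhesion.mono {ρ ρ' : ℝ} {q : I} {x : V} (h : B.NearAdhesion E W ρ q x)
    (hρ : ρ ≤ ρ') : B.NearAdhesion E W ρ' q x := by
  obtain ⟨v, hv, h⟩ := h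
  exact ⟨v, hv, h.mono hρ⟩

/-- A chain from `x` to the bag at `q` has to cross the adhesion set of any node between `q` and
`s`, and the rest of the chain keeps the crossing point near the bag at `q`. -/
theorem NearBag.of_le (hE : IsLengthRel E) {ρ : ℝ} {q q' s : I} {x : V}
    (h : B.NearBag E W ρ q x) (hqq' : q ≤ q') (hs : q' ≤ s) (hxs : x ∈ B.bag s) (hx : x ∈ W) :
    ∃ y, y ∈ W ∧ y ∈ B.bag q' ∧ B.NearBag E W ρ q y := by
  obtain ⟨v, hv, hvq, hxv⟩ := h
  by_cases hq : q' ≤ q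
  · obtain rfl := le_antisymm hqq' hq
    exact ⟨v, hv, hvq, v, hv, hvq, .refl _ (hxv.nonneg hE)⟩
  · obtain ⟨w, hw, _, hwv⟩ := hxv.exists_mem_adhesion hE hx hs hxs hq hvq
    exact ⟨w, hw.1, hw.2.1, v, hv, hvq, hwv⟩

variable (B E W) in
/-- `Q` is the greedily chosen set of nodes whose bags avoid the `ρ`-neighbourhood of the bag of
every smaller member of `Q`, and `a s` is the greatest member of `Q` below `s`. -/
structure IsAnchoring (ρ : ℝ) (Q : Set I) (a : I → I) : Prop where
  mem_iff : ∀ s, s ∈ Q ↔ ∀ q ∈ Q, q < s → ∀ x ∈ W, x ∈ B.bag s → ¬ B.NearBag E W ρ q x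
  mem : ∀ s, a s ∈ Q
  le : ∀ s, a s ≤ s
  le_of_mem : ∀ {q s}, q ∈ Q → q ≤ s → q ≤ a s

variable (B E W) in
theorem exists_isAnchoring [Finite I] (ρ : ℝ) : ∃ Q a, B.IsAnchoring E W ρ Q a := by
  have wf : WellFounded ((· < ·) : I → I → Prop) := wellFounded_lt
  let F : (s : I) → ((q : I) → q < s → Prop) → Prop := fun s ih =>
    ∀ q (h : q < s), ih q h → ∀ x ∈ W, x ∈ B.bag s → ¬ B.NearBag E W ρ q x
  let Q : Set I := {s | wf.fix F s}
  have hQ : ∀ s, s ∈ Q ↔ ∀ q ∈ Q, q < s → ∀ x ∈ W, x ∈ B.bag s → ¬ B.NearBag E W ρ q x := by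
    intro s
    change wf.fix F s ↔ _
    rw [wf.fix_eq]
    exact ⟨fun h q hq hqs => h q hqs hq, fun h q hqs hq => h q hq hqs⟩
  have ha : ∀ s, ∃ p, p ∈ Q ∧ p ≤ s ∧ ∀ q ∈ Q, q ≤ s → q ≤ p := by
    intro s
    -- A minimal node below `s` is vacuously in `Q`, so there is some anchor below `s`.
    obtain ⟨m, hms, hm⟩ := (Set.toFinite {t | t ≤ s}).exists_le_minimal (le_refl s)
    have hmQ : m ∈ Q := by
      rw [hQ]
      intro q _ hqm
      exact absurd (hm.2 (hqm.le.trans hms) hqm.le) (not_le_of_gt hqm)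
    obtain ⟨p, _, hp⟩ := (Set.toFinite {q | q ∈ Q ∧ q ≤ s}).exists_le_maximal ⟨hmQ, hms⟩
    refine ⟨p, hp.1.1, hp.1.2, fun q hq hqs => ?_⟩
    rcases B.total hqs hp.1.2 with h | h
    · exact h
    · exact hp.2 ⟨hq, hqs⟩ h
  choose a h1 h2 h3 using ha
  exact ⟨Q, a, hQ, h1, h2, fun {q s} => h3 s q⟩

variable (B E W) in
/-- The vertices assigned to the anchor `m` that are far from its bag. -/
def region (ρ : ℝ) (a : I → I) (m : I) : Set V :=
  {x | x ∈ W ∧ a (B.top x) = m ∧ ¬ B.NearBag E W ρ m x}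

namespace IsAnchoring

variable {ρ : ℝ} {Q : Set I} {a : I → I}

theorem eq_of_mem (H : B.IsAnchoring E W ρ Q a) {q : I} (hq : q ∈ Q) : a q = q :=
  le_antisymm (H.le q) (H.le_of_mem hq le_rfl)

/-- A greater anchor between `q` and `s` would have a vertex of its bag within `ρ` of the bag at
`q`, contrary to the greedy choice. -/
theorem eq_of_nearBag (H : B.IsAnchoring E W ρ Q a) (hE : IsLengthRel E) {q s : I} {x : V}
    (hq : q ∈ Q) (hqs : q ≤ s) (hx : x ∈ W) (hxs : x ∈ B.bag s) (h : B.NearBag E W ρ q x) :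
    a s = q := by
  by_contra hne
  have hlt : q < a s := lt_of_le_of_ne (H.le_of_mem hq hqs) (Ne.symm hne)
  obtain ⟨y, hy, hya, hyq⟩ := h.of_le hE hlt.le (H.le s) hxs hx
  exact (H.mem_iff _).1 (H.mem s) q hq hlt y hy hya hyq

theorem exists_nearBag (H : B.IsAnchoring E W ρ Q a) (hE : IsLengthRel E) (hρ : 0 ≤ ρ) {s : I}
    (hs : (B.bag s ∩ W).Nonempty) : ∃ x ∈ W, x ∈ B.bag s ∧ B.NearBag E W ρ (a s) x := by
  by_cases hsQ : s ∈ Q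
  · obtain ⟨x, hxs, hx⟩ := hs
    rw [H.eq_of_mem hsQ]
    exact ⟨x, hx, hxs, x, hx, hxs, .refl _ hρ⟩
  · rw [H.mem_iff] at hsQ
    push Not at hsQ
    obtain ⟨q, hq, hqs, x, hx, hxs, h⟩ := hsQ
    rw [H.eq_of_nearBag hE hq hqs.le hx hxs h]
    exact ⟨x, hx, hxs, h⟩

theorem not_le_top (H : B.IsAnchoring E W ρ Q a) {m q : I} {y : V} (hy : a (B.top y) = m)
    (hq : q ∈ Q) (hmq : m < q) : ¬ q ≤ B.top y := by
  intro hqy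
  have := H.le_of_mem hq hqy
  rw [hy] at this
  exact not_lt_of_ge this hmq

/-- Let `v` have the greatest top node among the vertices in question. All of them lie in the bag at
`B.top v`. That bag also contains a vertex within `ρ` of the bag at `m`, which is outside the
region, so at least one vertex is lost. -/
theorem ncard_bag_inter_region_le [Finite V] (H : B.IsAnchoring E W ρ Q a) (hE : IsLengthRel E)
    (hρ : 0 ≤ ρ) {k : ℕ} (hk : ∀ s, (B.bag s ∩ W).ncard ≤ k + 1) (m s : I) :
    (B.bag s ∩ B.region E W ρ a m).ncard ≤ k := by
  rcases (B.bag s ∩ B.region E W ρ a m).eq_empty_or_nonempty with h | h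
  · simp [h]
  obtain ⟨_, ⟨v, hv, rfl⟩, hmax⟩ :=
    (Set.toFinite (B.top '' (B.bag s ∩ B.region E W ρ a m))).exists_maximal (h.image _)
  obtain ⟨x, hx, hxv, hxm⟩ := H.exists_nearBag hE hρ ⟨v, B.top_mem v, hv.2.1⟩
  rw [hv.2.2.1] at hxm
  have hsub : B.bag s ∩ B.region E W ρ a m ⊆ (B.bag (B.top v) ∩ W) \ {x} := by
    rintro y ⟨hys, hy⟩
    refine ⟨⟨B.convex ?_ (B.top_le hv.1) hys, hy.1⟩, ?_⟩
    · rcases B.total (B.top_le hys) (B.top_le hv.1) with h | h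
      · exact h
      · exact hmax ⟨y, ⟨hys, hy⟩, rfl⟩ h
    · rintro rfl
      exact hy.2.2 hxm
  have h1 := Set.ncard_le_ncard hsub
  have h2 := Set.ncard_sdiff_singleton_add_one (s := B.bag (B.top v) ∩ W) ⟨hxv, hx⟩
  have := hk (B.top v)
  omega

/-- Short chains that end in the region of `m` can be shortcut inside the region, unless
they start near the bag at `m`. -/
theorem within_region_or_nearBag_aux (H : B.IsAnchoring E W ρ Q a) (hE : IsLengthRel E) (hρ : 0 ≤ ρ)
    {m : I} {x v : V} {l : ℝ} (h : B.Within E W x v l) (hx : x ∈ W)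
    (hv : v ∈ B.region E W ρ a m) :
    B.NearBag E W (l + ρ) m x ∨
      (x ∈ B.region E W ρ a m ∧ B.Within E (B.region E W ρ a m) x v l) ∨
      -- This alternative describes an excursion: `x` lies above a further anchor `q`, and the chain
      -- is shortcut to a vertex `y` of the region in the bag at `q`.
      ∃ y ∈ B.region E W ρ a m, ∃ q ∈ Q, m < q ∧ q ≤ B.top x ∧ y ∈ B.bag q ∧
        ∃ b c, E x y b ∧ B.Within E (B.region E W ρ a m) y v c ∧ b + c ≤ l := by
  induction h with
  | refl x hl => exact Or.inr (Or.inl ⟨hv, .refl _ hl⟩)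
  | @cons x x' z s b c _ hx' hxs hx's hxx' h ih =>
    have hb := hE.nonneg hxx'
    have hc := h.nonneg hE
    by_cases hmx : m ≤ B.top x
    swap
    · left
      have hmz : m ≤ B.top z := by rw [← hv.2.1]; exact H.le _
      obtain ⟨w, hw, _, hwx⟩ := ((Within.cons hx hx' hxs hx's hxx' h).symm hE).exists_mem_adhesion
        hE hv.1 hmz (B.top_mem _) hmx (B.top_mem _)
      exact ⟨w, hw.1, hw.2.1, (hwx.symm hE).mono (by linarith)⟩
    by_cases hxN : B.NearBag E W ρ m x
    · left
      obtain ⟨w, hw, hw', h⟩ := hxN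
      exact ⟨w, hw, hw', h.mono (by linarith)⟩
    have hma : m ≠ a (B.top x) → m < a (B.top x) := by
      intro hne
      refine lt_of_le_of_ne (H.le_of_mem ?_ hmx) hne
      rw [← hv.2.1]
      exact H.mem _
    rcases ih hx' hv with ⟨w, hw, hw', h⟩ | ⟨hx'r, h⟩ |
        ⟨y, hy, q, hq, hmq, hqx', hyq, b', c', h1, h2, h3⟩
    · left
      exact ⟨w, hw, hw', (Within.cons hx hx' hxs hx's hxx' h).mono (by linarith)⟩
    · right
      by_cases hxm : m = a (B.top x)
      · have hxr : x ∈ B.region E W ρ a m := ⟨hx, hxm.symm, hxN⟩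
        exact Or.inl ⟨hxr, .cons hxr hx'r hxs hx's hxx' h⟩
      · exact Or.inr ⟨x', hx'r, a (B.top x), H.mem _, hma hxm, H.le _,
          mem_bag_of_not_le hx's ((H.le _).trans (B.top_le hxs))
            (H.not_le_top hx'r.2.1 (H.mem _) (hma hxm)), b, c, hxx', h, le_rfl⟩
    · right
      have hqs : q ≤ s := hqx'.trans (B.top_le hx's)
      by_cases hxm : m = a (B.top x)
      · have hxr : x ∈ B.region E W ρ a m := ⟨hx, hxm.symm, hxN⟩
        -- The excursion begins and ends in the bag at `q`, so a single step from `x` to `y`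
        -- replaces it.
        have hxq := mem_bag_of_not_le hxs hqs (H.not_le_top hxm.symm hq hmq)
        exact Or.inl ⟨hxr, (Within.cons hxr hy hxq hyq (hE.trans hxx' h1) h2).mono (by linarith)⟩
      · right
        refine ⟨y, hy, ?_⟩
        by_cases hqx : q ≤ B.top x
        · exact ⟨q, hq, hmq, hqx, hyq, b + b', c', hE.trans hxx' h1, h2, by linarith⟩
        -- The excursion continues above the anchor of `x` instead of `q`; by convexity `y` is in
        -- the bag of that anchor too.
        · have hxq : B.top x ≤ q := (B.total (B.top_le hxs) hqs).resolve_right hqx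
          exact ⟨a (B.top x), H.mem _, hma hxm, H.le _, mem_bag_of_not_le hyq ((H.le _).trans hxq)
            (H.not_le_top hy.2.1 (H.mem _) (hma hxm)), b + b', c', hE.trans hxx' h1, h2,
            by linarith⟩

theorem within_region_or_nearBag (H : B.IsAnchoring E W ρ Q a) (hE : IsLengthRel E) (hρ : 0 ≤ ρ)
    {m : I} {x v : V} {l : ℝ} (h : B.Within E W x v l) (hx : x ∈ B.region E W ρ a m)
    (hv : v ∈ B.region E W ρ a m) :
    B.Within E (B.region E W ρ a m) x v l ∨ B.NearBag E W (l + ρ) m x := by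
  rcases H.within_region_or_nearBag_aux hE hρ h hx.1 hv with h | h | ⟨y, hy, q, hq, hmq, hqx, _⟩
  · exact Or.inr h
  · exact Or.inl h.2
  · exact absurd hqx (H.not_le_top hx.2.1 hq hmq)

end IsAnchoring

end RootedBags

/-! ### The layered colouring and the stage of a component -/

namespace RootedBags

variable {V I : Type*} [PartialOrder I] {B : RootedBags V I} {E : V → V → ℝ → Prop} {W : Set V}
  {r : ℝ} {Q : Set I} {a : I → I} {g : I → V → Bool} {c : V → Bool}

variable (B E W) in
/-- The colouring extends the colours of each adhesion set to its `r`-neighbourhood, surrounds the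
latter by two layers of different colours, and is given by `g` further away. -/
structure IsLayered (r : ℝ) (a : I → I) (g : I → V → Bool) (c : V → Bool) : Prop where
  near : ∀ x, B.NearAdhesion E W r (a (B.top x)) x →
    ∃ v ∈ B.adhesion W (a (B.top x)), B.Within E W x v r ∧ c x = c v
  inner : ∀ x, ¬ B.NearAdhesion E W r (a (B.top x)) x →
    B.NearAdhesion E W (2 * r) (a (B.top x)) x → c x = false
  outer : ∀ x, ¬ B.NearAdhesion E W (2 * r) (a (B.top x)) x →
    B.NearAdhesion E W (3 * r) (a (B.top x)) x → c x = true
  far : ∀ x, ¬ B.NearAdhesion E W (3 * r) (a (B.top x)) x → c x = g (a (B.top x)) x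

theorem top_lt_of_mem_adhesion {v : V} {q : I} (hv : v ∈ B.adhesion W q) : B.top v < q :=
  lt_of_le_not_ge (B.top_le hv.2.1) hv.2.2

variable (B E W) in
theorem exists_isLayered [Finite I] (hr : 0 ≤ r) (ha : ∀ s, a s ≤ s) (g : I → V → Bool) :
    ∃ c, B.IsLayered E W r a g c := by
  classical
  let P : V → Prop := fun x => B.NearAdhesion E W r (a (B.top x)) x
  have hP : ∀ x, ∃ v, P x → v ∈ B.adhesion W (a (B.top x)) ∧ B.Within E W x v r := by
    intro x
    by_cases h : P x
    · obtain ⟨v, h1, h2⟩ := h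
      exact ⟨v, fun _ => ⟨h1, h2⟩⟩
    · exact ⟨x, fun h' => absurd h' h⟩
  choose p hp using hP
  -- Colours are copied only from vertices with a strictly smaller top node, so the recursion along
  -- `B.top` is well-founded.
  have hlt : ∀ x, P x → B.top (p x) < B.top x := fun x h =>
    (top_lt_of_mem_adhesion (hp x h).1).trans_le (ha _)
  have wf : WellFounded (fun x y : V => B.top x < B.top y) := InvImage.wf B.top wellFounded_lt
  let g' : V → Bool := fun x =>
    if B.NearAdhesion E W (2 * r) (a (B.top x)) x then false
    else if B.NearAdhesion E W (3 * r) (a (B.top x)) x then true else g (a (B.top x)) x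
  let F : (x : V) → ((y : V) → B.top y < B.top x → Bool) → Bool := fun x ih =>
    if h : P x then ih (p x) (hlt x h) else g' x
  have h1 : ∀ x, P x → wf.fix F x = wf.fix F (p x) := by
    intro x h
    rw [wf.fix_eq]
    simp only [F, dif_pos h]
  have h2 : ∀ x, ¬ P x → wf.fix F x = g' x := by
    intro x h
    rw [wf.fix_eq]
    simp only [F, dif_neg h]
  refine ⟨wf.fix F, fun x hx => ⟨p x, (hp x hx).1, (hp x hx).2, h1 x hx⟩, fun x hx hx2 => ?_,
    fun x hx hx3 => ?_, fun x hx => ?_⟩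
  · rw [h2 x hx]; simp only [g', if_pos hx2]
  · rw [h2 x fun h => hx (h.mono (by linarith))]; simp only [g', if_neg hx, if_pos hx3]
  · rw [h2 x fun h => hx (h.mono (by linarith))]
    simp only [g', if_neg hx, if_neg fun h : B.NearAdhesion E W (2 * r) (a (B.top x)) x =>
      hx (h.mono (by linarith))]

variable (B E W) in
/-- Two vertices of the same colour at distance at most `r`. -/
def MonoAdj (r : ℝ) (c : V → Bool) (x y : V) : Prop :=
  x ∈ W ∧ y ∈ W ∧ c x = c y ∧ B.Within E W x y r

theorem MonoAdj.symm (hE : IsLengthRel E) {x y : V} (h : B.MonoAdj E W r c x y) :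
    B.MonoAdj E W r c y x := ⟨h.2.1, h.1, h.2.2.1.symm, h.2.2.2.symm hE⟩

variable (B E W) in
/-- The vertices whose monochromatic components may be attached to the adhesion set of `p`. -/
def Zone (r : ℝ) (c : V → Bool) (p : I) (x : V) : Prop :=
  B.NearAdhesion E W r p x ∨ (c x = false ∧ B.NearAdhesion E W (2 * r) p x)

theorem Zone.nearAdhesion {p : I} {x : V} (hr : 0 ≤ r) (h : B.Zone E W r c p x) :
    B.NearAdhesion E W (2 * r) p x := by
  rcases h with h | h
  · exact h.mono (by linarith)
  · exact h.2

theorem NearAdhesion.trans {ρ ρ' : ℝ} {p : I} {x y : V} (h : B.NearAdhesion E W ρ p y)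
    (hxy : B.Within E W x y ρ') : B.NearAdhesion E W (ρ' + ρ) p x := by
  obtain ⟨v, hv, h⟩ := h
  exact ⟨v, hv, hxy.trans h⟩

namespace IsLayered

theorem anchor_eq (H : B.IsAnchoring E W (3 * r) Q a) (hE : IsLengthRel E) {p : I} {x : V}
    (hx : x ∈ W) (hp : p ∈ Q) (hpx : p ≤ B.top x) (h : B.NearAdhesion E W (3 * r) p x) :
    a (B.top x) = p :=
  H.eq_of_nearBag hE hp hpx hx (B.top_mem x) h.nearBag

/-- Leaving a zone of the same colour by a short step is only possible through the adhesion set. -/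
theorem zone_of_monoAdj (C : B.IsLayered E W r a g c) (H : B.IsAnchoring E W (3 * r) Q a)
    (hE : IsLengthRel E) (hr : 0 ≤ r) {x y : V} (h : B.MonoAdj E W r c x y) {p : I} (hp : p ∈ Q)
    (hpx : p ≤ B.top x) (hy : B.Zone E W r c p y) :
    B.Zone E W r c p x := by
  obtain ⟨hx, -, hc, hxy⟩ := h
  have key : B.NearAdhesion E W (3 * r) p x :=
    ((hy.nearAdhesion hr).trans hxy).mono (by linarith)
  have hax := anchor_eq H hE hx hp hpx key
  by_cases h1 : B.NearAdhesion E W r p x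
  · exact Or.inl h1
  have hx2 : B.NearAdhesion E W (2 * r) p x := by
    rcases hy with hy | ⟨hy, -⟩
    · exact (hy.trans hxy).mono (by linarith)
    -- One step from distance at most `2 * r` ends within `3 * r`; beyond `2 * r` that is the layer
    -- of colour `true`, whereas `y` has colour `false`.
    · by_contra h2
      have := C.outer x (by rwa [hax]) (by rwa [hax])
      rw [hc, hy] at this
      exact Bool.false_ne_true this
  exact Or.inr ⟨C.inner x (by rwa [hax]) (by rwa [hax]), hx2⟩

variable (B E W) in
/-- `m` is the greatest anchor below `x` to whose zone `x` does not belong. -/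
structure IsStage (r : ℝ) (Q : Set I) (c : V → Bool) (m : I) (x : V) : Prop where
  mem : m ∈ Q
  le : m ≤ B.top x
  not_zone : ¬ B.Zone E W r c m x
  max : ∀ p ∈ Q, p ≤ B.top x → ¬ B.Zone E W r c p x → p ≤ m

theorem le_top_of_monoAdj (hE : IsLengthRel E) {x y : V} (h : B.MonoAdj E W r c x y) {p : I}
    (hpx : p ≤ B.top x) (hx : ¬ B.NearAdhesion E W r p x) : p ≤ B.top y := by
  by_contra hy
  obtain ⟨w, hw, hxw, -⟩ :=
    h.2.2.2.exists_mem_adhesion hE h.1 hpx (B.top_mem x) hy (B.top_mem y)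
  exact hx ⟨w, hw, hxw⟩

/-- A monochromatic step from a vertex above an anchor and outside its zone neither drops below the
anchor nor enters the zone. Hence the stage is an invariant of the component. -/
theorem isStage_of_monoAdj (C : B.IsLayered E W r a g c) (H : B.IsAnchoring E W (3 * r) Q a)
    (hE : IsLengthRel E) (hr : 0 ≤ r) {x y : V} (h : B.MonoAdj E W r c x y) {m : I}
    (hx : IsStage B E W r Q c m x) : IsStage B E W r Q c m y := by
  refine ⟨hx.mem, le_top_of_monoAdj hE h hx.le fun h' => hx.not_zone (Or.inl h'),
    fun h' => hx.not_zone (C.zone_of_monoAdj H hE hr h hx.mem hx.le h'), fun p hp hpy hy => ?_⟩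
  exact hx.max p hp (le_top_of_monoAdj hE (h.symm hE) hpy fun h' => hy (Or.inl h'))
    fun h' => hy (C.zone_of_monoAdj H hE hr (h.symm hE) hp hpy h')

theorem isStage_of_not_zone (H : B.IsAnchoring E W (3 * r) Q a) {x : V}
    (h : ¬ B.Zone E W r c (a (B.top x)) x) : IsStage B E W r Q c (a (B.top x)) x :=
  ⟨H.mem _, H.le _, h, fun _ hp hpx _ => H.le_of_mem hp hpx⟩

/-- No anchor lies strictly between `a (B.top v)` and `a (B.top x)`: its bag would share `v` with
the bag at `a (B.top x)`. Moreover `x` is not in the zone of the lower anchor, as it would then be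
assigned to it. -/
theorem isStage_of_mem_adhesion (H : B.IsAnchoring E W (3 * r) Q a) (hE : IsLengthRel E)
    (hr : 0 ≤ r) {x v : V} (hx : x ∈ W) (h : B.Zone E W r c (a (B.top x)) x)
    (hv : v ∈ B.adhesion W (a (B.top x))) : IsStage B E W r Q c (a (B.top v)) x := by
  have hlt : a (B.top v) < a (B.top x) := (H.le _).trans_lt (top_lt_of_mem_adhesion hv)
  refine ⟨H.mem _, hlt.le.trans (H.le _), fun h' => ?_, fun p hp hpx h' => ?_⟩
  · have := anchor_eq H hE hx (H.mem _) (hlt.le.trans (H.le _))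
      ((h'.nearAdhesion hr).mono (by linarith))
    exact hlt.ne this.symm
  · have hpa : p < a (B.top x) :=
      lt_of_le_of_ne (H.le_of_mem hp hpx) (by rintro rfl; exact h' h)
    refine H.le_of_mem hp ?_
    by_contra hpv
    exact (H.mem_iff _).1 (H.mem _) p hp hpa v hv.1 hv.2.1
      ⟨v, hv.1, mem_bag_of_not_le hv.2.1 hpa.le hpv, .refl _ (by linarith)⟩

theorem IsStage.unique {m m' : I} {x : V} (h : IsStage B E W r Q c m x)
    (h' : IsStage B E W r Q c m' x) : m = m' :=
  le_antisymm (h'.max m h.mem h.le h.not_zone) (h.max m' h'.mem h'.le h'.not_zone)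

variable (B E W) in
/-- `y` is `x` itself or a nearby vertex of the same colour in the adhesion set below `x`. -/
def Rep (r : ℝ) (a : I → I) (c : V → Bool) (x y : V) : Prop :=
  (¬ B.Zone E W r c (a (B.top x)) x ∧ y = x) ∨
  (B.Zone E W r c (a (B.top x)) x ∧ y ∈ B.adhesion W (a (B.top x)) ∧ B.Within E W x y r ∧ c x = c y)

theorem Rep.within (hr : 0 ≤ r) {x y : V} (h : Rep B E W r a c x y) : B.Within E W x y r := by
  rcases h with ⟨-, rfl⟩ | h
  · exact .refl _ hr
  · exact h.2.2.1

theorem Rep.color_eq {x y : V} (h : Rep B E W r a c x y) : c x = c y := by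
  rcases h with ⟨-, rfl⟩ | h
  · rfl
  · exact h.2.2.2

theorem Rep.mem {x y : V} (hx : x ∈ W) (h : Rep B E W r a c x y) : y ∈ W := by
  rcases h with ⟨-, rfl⟩ | h
  · exact hx
  · exact h.2.1.1

theorem Rep.anchor_eq (H : B.IsAnchoring E W (3 * r) Q a) (hE : IsLengthRel E) (hr : 0 ≤ r)
    {x y : V} {m : I} (hx : x ∈ W) (h : Rep B E W r a c x y) (hm : IsStage B E W r Q c m x) :
    a (B.top y) = m := by
  rcases h with ⟨h, rfl⟩ | h
  · exact (isStage_of_not_zone H h).unique hm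
  · exact (isStage_of_mem_adhesion H hE hr hx h.1 h.2.1).unique hm

/-- A vertex of the zone without a representative is not within `r` of the adhesion set, so a short
step cannot take it below its anchor; a monochromatic one keeps it in the zone. -/
theorem exists_rep_or (C : B.IsLayered E W r a g c) (H : B.IsAnchoring E W (3 * r) Q a)
    (hE : IsLengthRel E) (hr : 0 ≤ r) {x y : V} (h : B.MonoAdj E W r c x y) :
    (∃ z, Rep B E W r a c x z) ∨ (a (B.top y) = a (B.top x) ∧
      B.Zone E W r c (a (B.top x)) x ∧ B.Zone E W r c (a (B.top x)) y) := by
  by_cases hx : B.Zone E W r c (a (B.top x)) x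
  swap
  · exact Or.inl ⟨x, Or.inl ⟨hx, rfl⟩⟩
  by_cases hx1 : B.NearAdhesion E W r (a (B.top x)) x
  · obtain ⟨v, hv, h1, h2⟩ := C.near x hx1
    exact Or.inl ⟨v, Or.inr ⟨hx, hv, h1, h2⟩⟩
  · right
    have hy := le_top_of_monoAdj hE h (H.le _) hx1
    have hyZ := C.zone_of_monoAdj H hE hr (h.symm hE) (H.mem _) hy hx
    exact ⟨IsLayered.anchor_eq H hE h.2.1 (H.mem _) hy ((hyZ.nearAdhesion hr).mono (by linarith)),
      hx, hyZ⟩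

variable (B E W) in
/-- A short step between two vertices near the adhesion set of `q`. -/
def AdhesionAdj (r : ℝ) (q : I) (x y : V) : Prop :=
  B.NearAdhesion E W (2 * r) q x ∧ B.NearAdhesion E W (2 * r) q y ∧ B.Within E W x y r

theorem within_of_adhesionAdj [Finite V] (hE : IsLengthRel E) (hr : 0 ≤ r) {k : ℕ}
    (hk : ∀ s, (B.bag s ∩ W).ncard ≤ k) {q : I} {x y : V}
    (h : ReflTransGen (AdhesionAdj B E W r q) x y) :
    B.Within E W x y (ballBound r (2 * r) 0 k) := by
  classical
  have hfin : (B.adhesion W q).Finite := Set.toFinite _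
  have hcard : hfin.toFinset.card ≤ k := by
    rw [← Set.ncard_eq_toFinset_card _ hfin]
    exact (Set.ncard_le_ncard fun v hv => (⟨hv.2.1, hv.1⟩ : v ∈ B.bag q ∩ W)).trans (hk q)
  refine Within.mono ?_ (ballBound_mono hr (by linarith) le_rfl hcard)
  refine (isLengthRel_within hE).chain_le_ballBound hr (by linarith) le_rfl _
    (AdhesionAdj B E W r q) (fun x y h => ⟨h.2.1, h.1, h.2.2.symm hE⟩) (fun x y h => h.2.2)
    (fun x y h => ?_) x y h
  -- Every step has both ends inside the balls around the adhesion set, so only trivial chains avoid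
  -- all the balls and `b = 0` suffices.
  induction h with
  | refl => exact .refl _ le_rfl
  | tail _ h _ =>
    obtain ⟨⟨-, ⟨v, hv, hv'⟩, -⟩, -, h⟩ := h
    exact absurd hv' (h v (by simpa using hv))

variable (B E W) in
/-- A monochromatic step between two vertices assigned to `m`. -/
def AnchorAdj (r : ℝ) (a : I → I) (c : V → Bool) (m : I) (x y : V) : Prop :=
  B.MonoAdj E W r c x y ∧ a (B.top x) = m ∧ a (B.top y) = m

/-- Outside the balls of radius `r' + 3 * r` around the bag at `m`, all vertices of the chain are in
the region and coloured by `g m`, and each step can be shortcut inside the region. The bound `D`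
applies there. -/
theorem within_of_anchorAdj [Finite V] (C : B.IsLayered E W r a g c)
    (H : B.IsAnchoring E W (3 * r) Q a) (hE : IsLengthRel E) (hr : 0 ≤ r) {k : ℕ}
    (hk : ∀ s, (B.bag s ∩ W).ncard ≤ k) {r' D : ℝ} (hr' : 0 ≤ r') (hD : 0 ≤ D) {m : I}
    (hg : ∀ x y, ReflTransGen (B.MonoAdj E (B.region E W (3 * r) a m) r' (g m)) x y →
      B.Within E (B.region E W (3 * r) a m) x y D) {x y : V}
    (h : ReflTransGen (AnchorAdj B E W r' a c m) x y) :
    B.Within E W x y (ballBound r' (r' + 3 * r) D k) := by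
  classical
  have hfin : (B.bag m ∩ W).Finite := Set.toFinite _
  have hcard : hfin.toFinset.card ≤ k := by
    rw [← Set.ncard_eq_toFinset_card _ hfin]
    exact hk m
  refine Within.mono ?_ (ballBound_mono hr' (by linarith) hD hcard)
  refine (isLengthRel_within hE).chain_le_ballBound hr' (by linarith) hD _
    (AnchorAdj B E W r' a c m) (fun x y h => ⟨h.1.symm hE, h.2.2, h.2.1⟩) (fun x y h => h.1.2.2.2)
    (fun x y h => ?_) x y h
  refine (hg x y (ReflTransGen.mono ?_ _ _ h)).mono_set fun z hz => hz.1
  rintro x y ⟨⟨hxy, hxm, hym⟩, hx, hy⟩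
  have hnear : ∀ {z}, (∀ v ∈ hfin.toFinset, ¬ B.Within E W z v (r' + 3 * r)) →
      ¬ B.NearBag E W (r' + 3 * r) m z := by
    rintro z hz ⟨v, hv, hvm, h⟩
    exact hz v (by simp [hv, hvm]) h
  have hreg : ∀ {z}, z ∈ W → a (B.top z) = m →
      (∀ v ∈ hfin.toFinset, ¬ B.Within E W z v (r' + 3 * r)) →
      z ∈ B.region E W (3 * r) a m ∧ c z = g m z := by
    intro z hz hzm hzv
    have : ¬ B.NearBag E W (3 * r) m z := by
      rintro ⟨v, hv, hvm, h⟩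
      exact hnear hzv ⟨v, hv, hvm, h.mono (by linarith)⟩
    refine ⟨⟨hz, hzm, this⟩, ?_⟩
    have := C.far z (by rw [hzm]; exact fun h => this h.nearBag)
    rwa [hzm] at this
  obtain ⟨hxr, hxc⟩ := hreg hxy.1 hxm hx
  obtain ⟨hyr, hyc⟩ := hreg hxy.2.1 hym hy
  refine ⟨hxr, hyr, by rw [← hxc, ← hyc]; exact hxy.2.2.1, ?_⟩
  exact (H.within_region_or_nearBag hE (by linarith) hxy.2.2.2 hxr hyr).resolve_right (hnear hx)

end IsLayered

end RootedBags

/-! ### Bounding the components and the induction -/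

namespace RootedBags

variable {V I : Type*} [PartialOrder I] {B : RootedBags V I} {E : V → V → ℝ → Prop} {W : Set V}
  {r : ℝ} {Q : Set I} {a : I → I} {g : I → V → Bool} {c : V → Bool}

namespace IsLayered

variable (B E W) in
/-- `y` is `x` itself or a vertex of the adhesion set below `x`, joined to `x` near this set. -/
def Attached (r : ℝ) (a : I → I) (c : V → Bool) (x y : V) : Prop :=
  (¬ B.Zone E W r c (a (B.top x)) x ∧ y = x) ∨
  (B.Zone E W r c (a (B.top x)) x ∧ y ∈ B.adhesion W (a (B.top x)) ∧
    ReflTransGen (AdhesionAdj B E W r (a (B.top x))) x y)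

theorem Rep.attached (hr : 0 ≤ r) {x y : V} (h : Rep B E W r a c x y) :
    Attached B E W r a c x y := by
  rcases h with h | ⟨h, hy, hxy, -⟩
  · exact Or.inl h
  · exact Or.inr ⟨h, hy, .single ⟨h.nearAdhesion hr, ⟨y, hy, .refl _ (by linarith)⟩, hxy⟩⟩

theorem Attached.within [Finite V] (hE : IsLengthRel E) (hr : 0 ≤ r) {k : ℕ}
    (hk : ∀ s, (B.bag s ∩ W).ncard ≤ k) {x y : V} (h : Attached B E W r a c x y) :
    B.Within E W x y (ballBound r (2 * r) 0 k) := by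
  rcases h with ⟨-, rfl⟩ | ⟨-, -, h⟩
  · exact .refl _ (ballBound_nonneg hr (by linarith) le_rfl k)
  · exact within_of_adhesionAdj hE hr hk h

/-- The attached vertex follows the component step by step. It stays put while the component moves
inside one zone; otherwise it jumps to a representative of `x'`, over a distance of at most
`ballBound r (2 * r) 0 k + r + r`, which `r'` allows for. -/
theorem exists_attached [Finite V] (C : B.IsLayered E W r a g c)
    (H : B.IsAnchoring E W (3 * r) Q a) (hE : IsLengthRel E) (hr : 0 ≤ r) {k : ℕ}
    (hk : ∀ s, (B.bag s ∩ W).ncard ≤ k) {r' : ℝ} (hr' : ballBound r (2 * r) 0 k + 4 * r ≤ r')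
    {m : I} {x x' y : V} (h : B.MonoAdj E W r c x x') (hm : IsStage B E W r Q c m x)
    (hy : y ∈ W) (hym : a (B.top y) = m) (hyc : c y = c x) (hxy : Attached B E W r a c x y) :
    ∃ y', ReflTransGen (AnchorAdj B E W r' a c m) y y' ∧ y' ∈ W ∧ a (B.top y') = m ∧
      c y' = c x' ∧ Attached B E W r a c x' y' := by
  have hsame : (a (B.top x) = a (B.top x') ∧ B.Zone E W r c (a (B.top x)) x ∧
      B.Zone E W r c (a (B.top x)) x') ∨
      ((∃ z, Rep B E W r a c x z) ∧ ∃ z, Rep B E W r a c x' z) := by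
    rcases C.exists_rep_or H hE hr h with h1 | ⟨h1, h2, h3⟩
    · rcases C.exists_rep_or H hE hr (h.symm hE) with h2 | ⟨h2, h3, h4⟩
      · exact Or.inr ⟨h1, h2⟩
      · rw [← h2] at h3 h4
        exact Or.inl ⟨h2, h4, h3⟩
    · exact Or.inl ⟨h1.symm, h2, h3⟩
  rcases hsame with ⟨h1, h2, h3⟩ | ⟨⟨z, hz⟩, z', hz'⟩
  · refine ⟨y, .refl, hy, hym, hyc.trans h.2.2.1, Or.inr ?_⟩
    rcases hxy with ⟨h4, -⟩ | ⟨-, h4, h5⟩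
    · exact absurd h2 h4
    · rw [← h1]
      exact ⟨h3, h4, h5.head ⟨h3.nearAdhesion hr, h2.nearAdhesion hr, h.2.2.2.symm hE⟩⟩
  · have hz'W := hz'.mem h.2.1
    have hz'm := hz'.anchor_eq H hE hr h.2.1 (C.isStage_of_monoAdj H hE hr h hm)
    have hcol : c y = c z' := by rw [hyc, h.2.2.1, hz'.color_eq]
    have hd := (((hxy.within hE hr hk).symm hE).trans h.2.2.2).trans (hz'.within hr)
    exact ⟨z', .single ⟨⟨hy, hz'W, hcol, hd.mono (by linarith)⟩, hym, hz'm⟩, hz'W, hz'm,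
      hz'.color_eq.symm, hz'.attached hr⟩

theorem within_of_monoAdj [Finite V] (C : B.IsLayered E W r a g c)
    (H : B.IsAnchoring E W (3 * r) Q a) (hE : IsLengthRel E) (hr : 0 ≤ r) {k : ℕ}
    (hk : ∀ s, (B.bag s ∩ W).ncard ≤ k) {r' D : ℝ} (hr' : ballBound r (2 * r) 0 k + 4 * r ≤ r')
    (hD : 0 ≤ D)
    (hg : ∀ m x y, ReflTransGen (B.MonoAdj E (B.region E W (3 * r) a m) r' (g m)) x y →
      B.Within E (B.region E W (3 * r) a m) x y D) {x y : V}
    (h : ReflTransGen (B.MonoAdj E W r c) x y) :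
    B.Within E W x y (2 * (ballBound r (2 * r) 0 k + ballBound r' (r' + 3 * r) D k)) := by
  have hF := ballBound_nonneg hr (by linarith : 0 ≤ 2 * r) le_rfl k
  have hr'0 : 0 ≤ r' := by linarith
  have hF' := ballBound_nonneg hr'0 (by linarith : 0 ≤ r' + 3 * r) hD k
  have hsymm : ∀ {x y}, ReflTransGen (B.MonoAdj E W r c) x y →
      ReflTransGen (B.MonoAdj E W r c) y x := by
    intro x y h
    induction h with
    | refl => exact .refl
    | tail _ h ih => exact ih.head (h.symm hE)
  by_cases hx : x ∈ W
  swap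
  · rcases h.cases_head with rfl | ⟨z, hz, -⟩
    · exact .refl _ (by linarith)
    · exact absurd hz.1 hx
  have hmem : ∀ {z}, ReflTransGen (B.MonoAdj E W r c) x z → z ∈ W := by
    intro z hz
    rcases hz.cases_tail with rfl | ⟨_, -, hz⟩
    · exact hx
    · exact hz.2.1
  -- If no vertex of the component has a representative, the whole component lies in the zone of one
  -- anchor and stays near one adhesion set.
  by_cases hrep : ∃ z, ReflTransGen (B.MonoAdj E W r c) x z ∧ ∃ z₀, Rep B E W r a c z z₀
  · obtain ⟨z, hxz, z₀, hz⟩ := hrep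
    have hzW := hmem hxz
    obtain ⟨m, hm⟩ : ∃ m, IsStage B E W r Q c m z := by
      rcases hz with ⟨h, -⟩ | ⟨h, hz₀, -⟩
      · exact ⟨_, isStage_of_not_zone H h⟩
      · exact ⟨_, isStage_of_mem_adhesion H hE hr hzW h hz₀⟩
    have key : ∀ {w}, ReflTransGen (B.MonoAdj E W r c) z w → IsStage B E W r Q c m w ∧
        ∃ y, ReflTransGen (AnchorAdj B E W r' a c m) z₀ y ∧ y ∈ W ∧ a (B.top y) = m ∧
          c y = c w ∧ Attached B E W r a c w y := by
      intro w hw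
      induction hw with
      | refl => exact ⟨hm, z₀, .refl, hz.mem hzW, hz.anchor_eq H hE hr hzW hm, hz.color_eq.symm,
          hz.attached hr⟩
      | tail _ h ih =>
        obtain ⟨hm, y, h1, h2, h3, h4, h5⟩ := ih
        obtain ⟨y', h6, h7⟩ := C.exists_attached H hE hr hk hr' h hm h2 h3 h4 h5
        exact ⟨C.isStage_of_monoAdj H hE hr h hm, y', h1.trans h6, h7⟩
    have hdist : ∀ {w}, ReflTransGen (B.MonoAdj E W r c) z w →
        B.Within E W z₀ w (ballBound r' (r' + 3 * r) D k + ballBound r (2 * r) 0 k) := by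
      intro w hw
      obtain ⟨-, y, h1, -, -, -, h2⟩ := key hw
      exact (C.within_of_anchorAdj H hE hr hk hr'0 hD (hg m) h1).trans
        ((h2.within hE hr hk).symm hE)
    have h1 := hdist (hsymm hxz)
    have h2 := hdist ((hsymm hxz).trans h)
    exact ((h1.symm hE).trans h2).mono (by linarith)
  · have key : ∀ {w}, ReflTransGen (B.MonoAdj E W r c) x w → a (B.top w) = a (B.top x) ∧
        B.Zone E W r c (a (B.top x)) w ∧
        ReflTransGen (AdhesionAdj B E W r (a (B.top x))) x w := by
      intro w hw
      induction hw with
      | refl =>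
        refine ⟨rfl, ?_, .refl⟩
        by_contra h
        exact hrep ⟨x, .refl, x, Or.inl ⟨h, rfl⟩⟩
      | @tail w w' hw h ih =>
        obtain ⟨h1, h2, h3⟩ := ih
        rcases C.exists_rep_or H hE hr h with h4 | ⟨h4, h5, h6⟩
        · exact absurd ⟨w, hw, h4⟩ hrep
        · rw [h1] at h4 h5 h6
          exact ⟨h4, h6, h3.tail ⟨h5.nearAdhesion hr, h6.nearAdhesion hr, h.2.2.2⟩⟩
    exact (within_of_adhesionAdj hE hr hk (key h).2.2).mono (by linarith)

end IsLayered

/-- Vertex sets meeting every bag in at most `k` vertices can be coloured with two colours such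
that the monochromatic `r`-components have bounded diameter. -/
theorem exists_coloring (k : ℕ) : ∀ r : ℝ, 0 ≤ r → ∃ D : ℝ, 0 ≤ D ∧
    ∀ (V : Type u) (I : Type) [Finite V] [Finite I] [PartialOrder I] (B : RootedBags V I)
      (E : V → V → ℝ → Prop) (W : Set V), IsLengthRel E → (∀ s, (B.bag s ∩ W).ncard ≤ k) →
      ∃ c : V → Bool, ∀ x y, ReflTransGen (B.MonoAdj E W r c) x y → B.Within E W x y D := by
  induction k with
  | zero =>
    refine fun r _ => ⟨0, le_rfl, fun V I _ _ _ B E W _ hk => ⟨fun _ => true, fun x y h => ?_⟩⟩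
    rcases h.cases_head with rfl | ⟨z, hz, -⟩
    · exact .refl _ le_rfl
    · have := hk (B.top x)
      rw [Nat.le_zero, Set.ncard_eq_zero] at this
      exact absurd (this ▸ ⟨B.top_mem x, hz.1⟩ : x ∈ (∅ : Set V)) (Set.notMem_empty x)
  | succ k ih =>
    intro r hr
    have hF := ballBound_nonneg hr (by linarith : 0 ≤ 2 * r) le_rfl (k + 1)
    set r' := ballBound r (2 * r) 0 (k + 1) + 4 * r with hr'
    have hr'0 : 0 ≤ r' := by linarith
    obtain ⟨D, hD, hcol⟩ := ih r' hr'0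
    have hF' := ballBound_nonneg hr'0 (by linarith : 0 ≤ r' + 3 * r) hD (k + 1)
    refine ⟨2 * (ballBound r (2 * r) 0 (k + 1) + ballBound r' (r' + 3 * r) D (k + 1)),
      by linarith, fun V I _ _ _ B E W hE hk => ?_⟩
    obtain ⟨Q, a, H⟩ := B.exists_isAnchoring E W (3 * r)
    have hg := fun m => hcol V I B E (B.region E W (3 * r) a m) hE
      (H.ncard_bag_inter_region_le hE (by linarith) hk m)
    choose g hg using hg
    obtain ⟨c, C⟩ := B.exists_isLayered E W hr H.le g
    exact ⟨c, fun x y h => C.within_of_monoAdj H hE hr hk le_rfl hD hg h⟩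

end RootedBags

/-! ### Rooting the tree of a tree-decomposition -/

namespace SimpleGraph

variable {ι : Type*} {T : SimpleGraph ι}

/-- The domination order of a connected graph with root `r`: `t ≤ s` if every walk from the root
to `s` visits `t`. -/
@[reducible]
def Connected.dominationOrder (hT : T.Connected) (r : ι) : PartialOrder ι where
  le t s := ∀ p : T.Walk r s, t ∈ p.support
  le_refl t p := p.end_mem_support
  le_trans t s u hts hsu p := by
    classical
    exact p.support_takeUntil_subset_support (hsu p) (hts _)
  le_antisymm t s hts hst := by
    classical
    obtain ⟨p, hp⟩ := hT.exists_isPath r s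
    by_contra hne
    exact Walk.endpoint_notMem_support_takeUntil hp (hts p) (Ne.symm hne) (hst _)

/-- Otherwise a path to `u` visits `s`, then `t` (the part up to `s` can be replaced by `q'`, which
avoids `t`), and then `s` again (replace the part up to `t` by `q`). -/
theorem Connected.dominationOrder_total (hT : T.Connected) (r : ι) {s t u : ι}
    (hs : ∀ p : T.Walk r u, s ∈ p.support) (ht : ∀ p : T.Walk r u, t ∈ p.support) :
    (∀ p : T.Walk r t, s ∈ p.support) ∨ ∀ p : T.Walk r s, t ∈ p.support := by
  classical
  by_contra! hcon
  obtain ⟨⟨q, hq⟩, q', hq'⟩ := hcon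
  obtain ⟨p, hp⟩ := hT.exists_isPath r u
  obtain ⟨A, A', -, hA', rfl⟩ := hp.mem_support_iff_exists_append.1 (hs p)
  have htA' : t ∈ A'.support := by
    have := ht (q'.append A')
    rw [Walk.mem_support_append_iff] at this
    exact this.resolve_left hq'
  obtain ⟨C, C', -, -, rfl⟩ := hA'.mem_support_iff_exists_append.1 htA'
  have hsC' : s ∈ C'.support := by
    have := hs (q.append C')
    rw [Walk.mem_support_append_iff] at this
    exact this.resolve_left hq
  have hne : s ≠ t := by
    rintro rfl
    exact hq q.end_mem_support
  exact hA'.ne_of_mem_support_of_append hne C.start_mem_support hsC' rfl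

theorem IsTree.mem_support_of_isPath (hT : T.IsTree) {x y t : ι} {p : T.Walk x y} (hp : p.IsPath)
    (ht : t ∈ p.support) (q : T.Walk x y) : t ∈ q.support := by
  classical
  have := (hT.existsUnique_path x y).unique hp q.bypass_isPath
  rw [this] at ht
  exact q.support_bypass_subset_support ht

/-- A connected set of nodes of a rooted tree has a least node and is convex. -/
theorem IsTree.exists_least (hT : T.IsTree) (r : ι) {S : Set ι} (hS : (T.induce S).Connected) :
    ∃ t₀ ∈ S, (∀ s ∈ S, ∀ p : T.Walk r s, t₀ ∈ p.support) ∧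
      ∀ t s, s ∈ S → (∀ p : T.Walk r t, t₀ ∈ p.support) → (∀ p : T.Walk r s, t ∈ p.support) →
        t ∈ S := by
  classical
  obtain ⟨⟨s₀, hs₀⟩⟩ := hS.nonempty
  -- The least node is one of `S` nearest to the root: the path to it meets `S` only at its end, so
  -- it extends by a path inside `S` to a path to any `s ∈ S`.
  obtain ⟨t₀, ht₀, hmin⟩ : ∃ t₀ ∈ S, ∀ s ∈ S, T.dist r t₀ ≤ T.dist r s := by
    have hne : (T.dist r '' S).Nonempty := ⟨_, s₀, hs₀, rfl⟩
    obtain ⟨t₀, ht₀, h⟩ := Nat.sInf_mem hne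
    exact ⟨t₀, ht₀, fun s hs => h ▸ Nat.sInf_le ⟨s, hs, rfl⟩⟩
  obtain ⟨P, hP, hlen⟩ := hT.1.exists_path_of_dist r t₀
  have hPS : ∀ w ∈ P.support, w ∈ S → w = t₀ := by
    intro w hw hwS
    by_contra hne
    have h1 := P.length_takeUntil_lt_length hw hne
    have h2 := dist_le (P.takeUntil w hw)
    have h3 := hmin w hwS
    omega
  have hconn : ∀ s ∈ S, ∃ R : T.Walk t₀ s, (∀ w ∈ R.support, w ∈ S) ∧ (P.append R).IsPath := by
    intro s hs
    obtain ⟨R, hR, hRS⟩ : ∃ R : T.Walk t₀ s, R.IsPath ∧ ∀ w ∈ R.support, w ∈ S := by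
      obtain ⟨R', hR'⟩ := hS.exists_isPath ⟨t₀, ht₀⟩ ⟨s, hs⟩
      refine ⟨R'.map (Embedding.induce (G := T) S).toHom, hR'.map Subtype.val_injective, ?_⟩
      intro w hw
      obtain ⟨w', -, rfl⟩ := List.mem_map.1 ((Walk.support_map _ R') ▸ hw)
      exact w'.2
    refine ⟨R, hRS, ?_⟩
    rw [Walk.isPath_def, Walk.support_append, List.nodup_append']
    refine ⟨hP.support_nodup, hR.support_nodup.sublist (List.tail_sublist _), fun w hw hw' => ?_⟩
    obtain rfl := hPS w hw (hRS w (List.mem_of_mem_tail hw'))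
    have := hR.support_nodup
    rw [← Walk.cons_tail_support, List.nodup_cons] at this
    exact this.1 hw'
  refine ⟨t₀, ht₀, fun s hs => ?_, fun t s hs ht₀t hts => ?_⟩
  · obtain ⟨R, -, hPR⟩ := hconn s hs
    exact hT.mem_support_of_isPath hPR
      ((Walk.mem_support_append_iff _ _).2 (Or.inl P.end_mem_support))
  · obtain ⟨R, hRS, hPR⟩ := hconn s hs
    rcases (Walk.mem_support_append_iff _ _).1 (hts (P.append R)) with h | h
    · have : t = t₀ := (hT.1.dominationOrder r).le_antisymm _ _ (hT.mem_support_of_isPath hP h) ht₀t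
      exact this ▸ ht₀
    · exact hRS t h

end SimpleGraph

/-- Rooting the tree of a tree-decomposition. -/
theorem TreeDecomposition.exists_rootedBags {V : Type u} {G : SimpleGraph V}
    (D : TreeDecomposition G) :
    ∃ (_ : PartialOrder D.ι) (B : RootedBags V D.ι), B.bag = D.bag := by
  obtain ⟨r⟩ := D.isTree.1.nonempty
  choose top h1 h2 h3 using fun v => D.isTree.exists_least r (D.connected v)
  let _ := D.isTree.1.dominationOrder r
  let B : RootedBags V D.ι :=
    { bag := D.bag
      top := top
      top_mem := h1
      top_le := fun {v s} h => h2 v s h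
      convex := fun {v t s} h h' hs => h3 v t s hs h h'
      total := fun {s t u} h h' => D.isTree.1.dominationOrder_total r h h' }
  exact ⟨_, B, rfl⟩

theorem TreeDecomposition.ncard_bag_le {V : Type u} {G : SimpleGraph V}
    (D : TreeDecomposition G) {k : ℕ} (h : D.width ≤ k) (t : D.ι) :
    (D.bag t).ncard ≤ k + 1 := by
  have := D.finite
  have h1 := le_ciSup (f := fun t => (D.bag t).ncard) (Set.finite_range _).bddAbove t
  unfold TreeDecomposition.width at h
  have h2 : (D.bag t).ncard ≤ ⨆ t, (D.bag t).ncard := h1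
  omega

/-! ### Distances in weighted graphs and the control function -/

namespace WeightedGraph

variable (G : WeightedGraph.{u})

theorem length_append {x y z : G.V} (p : G.graph.Walk x y) (q : G.graph.Walk y z) :
    G.length (p.append q) = G.length p + G.length q := by
  induction p with
  | nil => simp [length]
  | cons h p ih =>
    rw [SimpleGraph.Walk.cons_append]
    simp only [length]
    rw [ih, add_assoc]

theorem length_reverse {x y : G.V} (p : G.graph.Walk x y) :
    G.length p.reverse = G.length p := by
  induction p with
  | nil => simp [length]
  | cons h p ih =>
    rw [SimpleGraph.Walk.reverse_cons, length_append, ih]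
    simp only [length]
    rw [add_zero, add_comm]
    congr 2
    exact Subtype.ext Sym2.eq_swap

theorem length_bypass_le [DecidableEq G.V] {x y : G.V} (p : G.graph.Walk x y) :
    G.length p.bypass ≤ G.length p := by
  induction p with
  | nil => simp [SimpleGraph.Walk.bypass]
  | @cons x x' y h p ih =>
    rw [SimpleGraph.Walk.bypass]
    split_ifs with hs
    · have := G.length_append (p.bypass.takeUntil x hs) (p.bypass.dropUntil x hs)
      rw [SimpleGraph.Walk.take_spec] at this
      simp only [length]
      calc _ ≤ G.length p.bypass := by rw [this]; exact le_add_self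
        _ ≤ _ := ih.trans le_add_self
    · simp only [length]
      gcongr

theorem dist_le_length {x y : G.V} (p : G.graph.Walk x y) : G.dist x y ≤ G.length p := by
  classical
  exact (iInf_le _ (⟨p.bypass, p.bypass_isPath⟩ : G.graph.Path x y)).trans (G.length_bypass_le p)

/-- There is a walk from `x` to `y` of length at most `a * r`. -/
def WalkWithin (r : ℝ) (x y : G.V) (a : ℝ) : Prop :=
  0 ≤ a ∧ ∃ p : G.graph.Walk x y, G.length p ≤ ENNReal.ofReal (a * r)

theorem isLengthRel_walkWithin {r : ℝ} (hr : 0 ≤ r) : IsLengthRel (G.WalkWithin r) where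
  nonneg h := h.1
  refl x := ⟨le_rfl, .nil, by simp [length]⟩
  symm := by
    rintro x y a ⟨ha, p, hp⟩
    exact ⟨ha, p.reverse, by rwa [length_reverse]⟩
  trans := by
    rintro x y z a b ⟨ha, p, hp⟩ ⟨hb, q, hq⟩
    refine ⟨add_nonneg ha hb, p.append q, ?_⟩
    rw [length_append, add_mul, ENNReal.ofReal_add (by positivity) (by positivity)]
    gcongr
  mono := by
    rintro x y a b ⟨ha, p, hp⟩ hab
    exact ⟨ha.trans hab, p, hp.trans (ENNReal.ofReal_le_ofReal (by gcongr))⟩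

theorem within_of_length_ne_top {I : Type} [PartialOrder I] (B : RootedBags G.V I)
    (hB : ∀ ⦃x y⦄, G.graph.Adj x y → ∃ t, x ∈ B.bag t ∧ y ∈ B.bag t) {r : ℝ} (hr : 0 < r)
    {x y : G.V} (p : G.graph.Walk x y) (hp : G.length p ≠ ⊤) :
    B.Within (G.WalkWithin r) Set.univ x y ((G.length p).toReal / r) := by
  induction p with
  | nil => exact .refl _ (by positivity)
  | @cons x x' y h p ih =>
    simp only [length] at hp ⊢
    obtain ⟨h1, h2⟩ := ENNReal.add_ne_top.1 hp
    obtain ⟨t, hx, hx'⟩ := hB h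
    rw [ENNReal.toReal_add h1 h2, add_div]
    refine .cons (Set.mem_univ _) (Set.mem_univ _) hx hx' ⟨by positivity, .cons h .nil, ?_⟩ (ih h2)
    rw [div_mul_cancel₀ _ hr.ne', ENNReal.ofReal_toReal h1]
    simp [length]

theorem within_of_dist_le {I : Type} [PartialOrder I] (B : RootedBags G.V I)
    (hB : ∀ ⦃x y⦄, G.graph.Adj x y → ∃ t, x ∈ B.bag t ∧ y ∈ B.bag t) {r : ℝ} (hr : 0 < r)
    {x y : G.V} (h : G.dist x y ≤ ENNReal.ofReal r) :
    B.Within (G.WalkWithin r) Set.univ x y 2 := by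
  have h1 : G.dist x y < ENNReal.ofReal (2 * r) :=
    h.trans_lt ((ENNReal.ofReal_lt_ofReal_iff (by linarith)).2 (by linarith))
  obtain ⟨p, hp⟩ := iInf_lt_iff.1 h1
  refine (G.within_of_length_ne_top B hB hr p.1 (hp.trans ENNReal.ofReal_lt_top).ne).mono ?_
  rw [div_le_iff₀ hr]
  exact ENNReal.toReal_le_of_le_ofReal (by linarith) hp.le

end WeightedGraph

/-- The control function obtained from the components of a colouring with two colours. -/
theorem exists_isControlFunction_of_treewidth_le (k : ℕ) :
    ∃ D : ℝ, 0 < D ∧ ∀ G : WeightedGraph.{u}, G.graph.treewidth ≤ k →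
      ∀ f : Set.Ioi (0 : ℝ) → Set.Ioi (0 : ℝ), (∀ r, (f r : ℝ) = D * r) →
        G.IsControlFunction 1 f := by
  -- Bags have at most `k + 1` vertices. In units of `r` the scale is `2`, not `1`: since the
  -- distance is an infimum, distance at most `r` is only used to get a path of length below `2 *
  -- r`.
  obtain ⟨D, hD, hcol⟩ := RootedBags.exists_coloring.{u} (k + 1) 2 (by norm_num)
  -- `D` may be zero, but the control function has to be positive.
  refine ⟨D + 1, by linarith, fun G hG f hf r => ?_⟩
  have hr : (0 : ℝ) < r := r.2
  obtain ⟨T, hT⟩ := G.graph.exists_width_eq_treewidth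
  have := T.finite
  obtain ⟨_, B, hB⟩ := T.exists_rootedBags
  have hE := G.isLengthRel_walkWithin hr.le
  obtain ⟨c, hc⟩ := hcol G.V T.ι B (G.WalkWithin r) Set.univ hE
    (fun s => by rw [Set.inter_univ, hB]; exact T.ncard_bag_le (hT ▸ hG) s)
  set R := B.MonoAdj (G.WalkWithin r) Set.univ 2 c
  have hsymm : ∀ {x y}, ReflTransGen R x y → ReflTransGen R y x := by
    intro x y h
    induction h with
    | refl => exact .refl
    | tail _ h ih => exact ih.head (h.symm hE)
  have hcolor : ∀ {x y}, ReflTransGen R x y → c x = c y := by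
    intro x y h
    induction h with
    | refl => rfl
    | tail _ h ih => exact ih.trans h.2.2.1
  refine ⟨fun i => {S | ∃ x, c x = decide (i = 0) ∧ S = {y | ReflTransGen R x y}}, ?_, ?_, ?_⟩
  · refine Set.eq_univ_of_forall fun x => ?_
    simp only [Set.mem_iUnion]
    refine ⟨if c x = true then 0 else 1, {y | ReflTransGen R x y}, ⟨x, ?_, rfl⟩, .refl⟩
    by_cases hx : c x = true <;> simp [hx]
  · rintro i _ ⟨x, hx, rfl⟩ _ ⟨y, hy, rfl⟩ hne z hz w hw
    by_contra! h
    apply hne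
    have hzw : R z w := ⟨trivial, trivial,
      by rw [← hcolor hz, ← hcolor hw, hx, hy],
      G.within_of_dist_le B (hB ▸ T.edge) hr h⟩
    have hxy : ReflTransGen R x y := (ReflTransGen.tail hz hzw).trans (hsymm hw)
    ext v
    exact ⟨fun hv => (hsymm hxy).trans hv, fun hv => hxy.trans hv⟩
  · rintro i _ ⟨x, -, rfl⟩
    refine iSup₂_le fun y hy => iSup₂_le fun z hz => ?_
    obtain ⟨-, p, hp⟩ := (hc y z ((hsymm hy).trans hz)).rel hE
    refine (G.dist_le_length p).trans (hp.trans (ENNReal.ofReal_le_ofReal ?_))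
    rw [hf]
    gcongr
    linarith

theorem mainTheorem8 (k : ℕ) (𝒢 : Set WeightedGraph.{u})
    (h𝒢 : ∀ G ∈ 𝒢, G.graph.treewidth ≤ (k : ℤ)) :
    ANdim 𝒢 ≤ 1 := by
  obtain ⟨D, hD, h⟩ := exists_isControlFunction_of_treewidth_le.{u} k
  let f : Set.Ioi (0 : ℝ) → Set.Ioi (0 : ℝ) := fun r => ⟨D * r, mul_pos hD r.2⟩
  exact iInf₂_le_of_le 1 ⟨f, ⟨D, hD, fun _ => le_rfl⟩,
    fun G hG => h G (h𝒢 G hG) f fun _ => rfl⟩ (by norm_num)
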